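/- Let $\Phi(p)=p/|p|^2$ be the inversion of $\mathbb R^3\setminus\{0\}$. For $a\in\mathbb R$, a regular surface $\Sigma\subset\mathbb R^3\setminus\{0\}$ is called $a$-stationary if $H(p)=a\,\langle\nu(p),p\rangle/|p|^2$ for all $p\in\Sigma$, where $\nu$ is a local unit normal and $H$ is the mean curvature with respect to $\nu$ (the sum of the principal curvatures, equal to $2/r$ for a sphere of radius $r$ with inward normal); the equation does not depend on the choice of $\nu$. There exist $-4$-stationary surfaces with the topology of a Möbius strip. More precisely, let $\alpha(s)=(\cos s,\sin s,0)$ and $V(s)=\cos(s/2)\,\alpha(s)+\sin(s/2)\,(0,0,1)$ for $s\in\mathbb R$. There are $\varepsilon>0$ and an immersed minimal surface $X:\mathbb R\times(-\varepsilon,\varepsilon)\to\mathbb R^3$, $X=X(s,t)$, which solves the Björling problem for $\{\alpha,V\}$, that is, $X(s,0)=\alpha(s)$ and the unit normal $X_s\times X_t/|X_s\times X_t|$ of $X$ at $(s,0)$ is $V(s)$ for all $s\in\mathbb R$, such that the image $M=X(\mathbb R\times(-\varepsilon,\varepsilon))$ is an embedded minimal surface, homeomorphic to the open Möbius strip, with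 $0\notin M$, and its inverse surface $\Phi(M)$ is an embedded $-4$-stationary surface, also homeomorphic to the open Möbius strip. -/

import Mathlib

/-- Euclidean three-space. -/
abbrev E3 : Type := EuclideanSpace ℝ (Fin 3)

namespace ParamSurface

/-- The partial derivative `X_s` of a map `X = X(s, t)`. -/
noncomputable def partialS (X : ℝ × ℝ → E3) (p : ℝ × ℝ) : E3 :=
  deriv (fun s => X (s, p.2)) p.1

/-- The partial derivative `X_t` of a map `X = X(s, t)`. -/
noncomputable def partialT (X : ℝ × ℝ → E3) (p : ℝ × ℝ) : E3 :=
  deriv (fun t => X (p.1, t)) p.2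

/-- The vector product of Euclidean three-space. -/
noncomputable def cross (v w : E3) : E3 :=
  WithLp.toLp 2 (crossProduct v.ofLp w.ofLp)

/-- The unit normal `ν = (X_s × X_t) / |X_s × X_t|`. -/
noncomputable def unitNormal (X : ℝ × ℝ → E3) (p : ℝ × ℝ) : E3 :=
  ‖cross (partialS X p) (partialT X p)‖⁻¹ • cross (partialS X p) (partialT X p)

/-- The mean curvature `H = (e G - 2 f F + g E) / (E G - F ^ 2)`, the sum of the principal
curvatures with respect to `unitNormal X`. A sphere of radius `r` has `H = 2 / r` with respect
to the inward normal. -/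
noncomputable def meanCurvature (X : ℝ × ℝ → E3) (p : ℝ × ℝ) : ℝ :=
  (inner ℝ (partialS (partialS X) p) (unitNormal X p)
        * inner ℝ (partialT X p) (partialT X p)
      - 2 * inner ℝ (partialT (partialS X) p) (unitNormal X p)
        * inner ℝ (partialS X p) (partialT X p)
      + inner ℝ (partialT (partialT X) p) (unitNormal X p)
        * inner ℝ (partialS X p) (partialS X p))
    / (inner ℝ (partialS X p) (partialS X p) * inner ℝ (partialT X p) (partialT X p)
        - inner ℝ (partialS X p) (partialT X p) ^ 2)

/-- `X` is a smooth immersion of the open set `Ω` into Euclidean three-space. -/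
structure IsImmersedOn (X : ℝ × ℝ → E3) (Ω : Set (ℝ × ℝ)) : Prop where
  isOpen : IsOpen Ω
  smooth : ContDiffOn ℝ (⊤ : ℕ∞) X Ω
  immersive : ∀ p ∈ Ω, LinearIndependent ℝ ![partialS X p, partialT X p]

/-- `X : Ω → S` is a local parametrization of the subset `S` of Euclidean three-space: a smooth
immersion that is a homeomorphism onto a relatively open subset of `S`. -/
structure IsLocalParam (S : Set E3) (Ω : Set (ℝ × ℝ)) (X : ℝ × ℝ → E3) : Prop
    extends IsImmersedOn X Ω where
  embedding : Topology.IsEmbedding (Ω.domRestrict X)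
  relOpen : ∃ W : Set E3, IsOpen W ∧ X '' Ω = S ∩ W

/-- `S` is an (embedded, regular) surface of Euclidean three-space with vanishing mean
curvature. -/
def IsMinimalSurface (S : Set E3) : Prop :=
  ∀ x ∈ S, ∃ (Ω : Set (ℝ × ℝ)) (X : ℝ × ℝ → E3), IsLocalParam S Ω X ∧ x ∈ X '' Ω ∧
    ∀ p ∈ Ω, meanCurvature X p = 0

/-- `S` is an (embedded, regular) surface of `ℝ³ - {0}` which satisfies
`H = a * ⟨ν, x⟩ / |x| ^ 2` at its points `x`. This equation does not depend on the local
parametrization; both sides change sign if `ν` is replaced by `-ν`, so it makes sense on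
non-orientable surfaces. -/
def IsStationarySurface (a : ℝ) (S : Set E3) : Prop :=
  (0 : E3) ∉ S ∧
  ∀ x ∈ S, ∃ (Ω : Set (ℝ × ℝ)) (X : ℝ × ℝ → E3), IsLocalParam S Ω X ∧ x ∈ X '' Ω ∧
    ∀ p ∈ Ω, meanCurvature X p = a * (inner ℝ (unitNormal X p) (X p) / ‖X p‖ ^ 2)

/-- `X : Ω → ℝ³` is a solution of the Björling problem with data `c, V : ℝ → ℝ³`: an immersed
minimal surface, parametrized on a domain of the plane that contains the axis `t = 0`, with
`X(s, 0) = c(s)` and with unit normal `V(s)` at `(s, 0)`. -/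
structure IsBjorlingSolution (c V : ℝ → E3) (Ω : Set (ℝ × ℝ)) (X : ℝ × ℝ → E3) : Prop
    extends IsImmersedOn X Ω where
  connected : IsConnected Ω
  axis_mem : ∀ s : ℝ, (s, 0) ∈ Ω
  minimal : ∀ p ∈ Ω, meanCurvature X p = 0
  curve : ∀ s : ℝ, X (s, 0) = c s
  normal : ∀ s : ℝ, unitNormal X (s, 0) = V s

/-- The unit circle `(cos s, sin s, 0)`. -/
noncomputable def unitCircle (s : ℝ) : E3 := !₂[Real.cos s, Real.sin s, 0]

/-- The half-twisting field `cos (s / 2) (cos s, sin s, 0) + sin (s / 2) (0, 0, 1)`. -/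
noncomputable def halfTwist (s : ℝ) : E3 :=
  Real.cos (s / 2) • unitCircle s + Real.sin (s / 2) • !₂[(0 : ℝ), 0, 1]

/-- The strip `|t| < ε` in the `(s, t)`-plane. -/
def strip (ε : ℝ) : Set (ℝ × ℝ) := {p | |p.2| < ε}

/-- The (open) Möbius strip: `[0, 1] × (-1, 1)` with `(0, t)` glued to `(1, -t)`, with the
quotient topology. -/
abbrev MobiusStrip : Type :=
  Quot fun p q : Set.Icc (0 : ℝ) 1 × Set.Ioo (-1 : ℝ) 1 =>
    (p.1 : ℝ) = 0 ∧ (q.1 : ℝ) = 1 ∧ (q.2 : ℝ) = -(p.2 : ℝ)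

end ParamSurface

namespace ParamSurface

open Real Topology EuclideanGeometry

/-! The Björling problem is solved explicitly by Schwarz's formula `X = Re (α(z) - i ∫ V × α' dz)`
with `z = s + i t`; this gives `mobiusMap`. Its components are harmonic, and its first fundamental
form is a positive multiple of `ds² + dt²` on the whole plane (`isConformalAt_mobiusMap`). In
conformal parameters `H` is the normal part of the Laplacian over the conformal factor, so the
immersion is minimal.

The inversion is conformal, so `Φ ∘ X` is again conformal, with factor `μ / |X|⁴`. For harmonic `X`
its Laplacian is tangential up to `-4 μ |X|⁻⁴ X`. Hence `H = -4 ⟨ν, X⟩`, which is `-4 ⟨ν, Φ(X)⟩ /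
|Φ(X)|²`.

For embeddedness put `w = x + i y = sinh (t/2) exp (i s/2)`, which is invariant under `(s, t) ↦ (s +
2π, -t)`. The height of `X` is `2x` and its horizontal part is `exp (i s) (A + i B)` with `A`, `B`
polynomials in `x`, `y`. For `|w| ≤ 1/10`, height and distance from the vertical axis determine `w`;
then `exp (i s)` is determined too, so `X` identifies exactly the orbits of that map
(`exists_int_of_mobiusMap_eq`). Compactness of closed rectangles upgrades this to embeddedness and
to a homeomorphism with the Möbius strip. The inversion, a homeomorphism of the punctured space,
carries everything to `Φ(M)`. -/

/-! ### Mean curvature in conformal parameters. -/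

theorem inner_eq_sum_three (v w : E3) : inner ℝ v w = v 0 * w 0 + v 1 * w 1 + v 2 * w 2 := by
  simp [PiLp.inner_apply, Fin.sum_univ_three, mul_comm]

theorem inner_left_cross (v w : E3) : inner ℝ v (cross v w) = 0 := by
  simp [inner_eq_sum_three, cross, crossProduct]
  ring

theorem inner_right_cross (v w : E3) : inner ℝ w (cross v w) = 0 := by
  simp [inner_eq_sum_three, cross, crossProduct]
  ring

theorem inner_partialS_unitNormal (X : ℝ × ℝ → E3) (p : ℝ × ℝ) :
    inner ℝ (partialS X p) (unitNormal X p) = 0 := by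
  rw [unitNormal, inner_smul_right, inner_left_cross, mul_zero]

theorem inner_partialT_unitNormal (X : ℝ × ℝ → E3) (p : ℝ × ℝ) :
    inner ℝ (partialT X p) (unitNormal X p) = 0 := by
  rw [unitNormal, inner_smul_right, inner_right_cross, mul_zero]

/-- The first fundamental form of `X` at `p` is `μ (ds² + dt²)` with `μ > 0`. -/
structure IsConformalAt (X : ℝ × ℝ → E3) (p : ℝ × ℝ) (μ : ℝ) : Prop where
  pos : 0 < μ
  inner_ss : inner ℝ (partialS X p) (partialS X p) = μ
  inner_st : inner ℝ (partialS X p) (partialT X p) = 0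
  inner_tt : inner ℝ (partialT X p) (partialT X p) = μ

theorem IsConformalAt.linearIndependent {X : ℝ × ℝ → E3} {p : ℝ × ℝ} {μ : ℝ}
    (h : IsConformalAt X p μ) : LinearIndependent ℝ ![partialS X p, partialT X p] := by
  rw [LinearIndependent.pair_iff]
  intro a b hab
  have h1 := congrArg (inner ℝ (partialS X p)) hab
  have h2 := congrArg (inner ℝ (partialT X p)) hab
  simp only [inner_add_right, inner_smul_right, inner_zero_right, h.inner_ss, h.inner_st,
    h.inner_tt, real_inner_comm (partialS X p) (partialT X p)] at h1 h2
  simpa [h.pos.ne'] using And.intro h1 h2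

/-- In conformal parameters the mean curvature is the normal component of the Laplacian divided
by the conformal factor. -/
theorem IsConformalAt.meanCurvature_eq {X : ℝ × ℝ → E3} {p : ℝ × ℝ} {μ : ℝ}
    (h : IsConformalAt X p μ) :
    meanCurvature X p =
      inner ℝ (partialS (partialS X) p + partialT (partialT X) p) (unitNormal X p) / μ := by
  have hμ := h.pos.ne'
  rw [meanCurvature, h.inner_ss, h.inner_st, h.inner_tt, inner_add_left]
  field_simp
  ring

/-! ### Inversion of conformal harmonic immersions. -/

theorem inversion_zero_one (x : E3) : inversion (0 : E3) 1 x = (‖x‖ ^ 2)⁻¹ • x := by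
  simp [inversion]

/-- The differential of the inversion at `x`, applied to `v`. -/
noncomputable def inversionDeriv (x v : E3) : E3 :=
  (‖x‖ ^ 2)⁻¹ • v - (2 * inner ℝ x v * ((‖x‖ ^ 2)⁻¹) ^ 2) • x

/-- The acceleration of the inverse of a curve with position `x`, velocity `v` and
acceleration `w`. -/
noncomputable def inversionDeriv₂ (x v w : E3) : E3 :=
  (‖x‖ ^ 2)⁻¹ • w - (4 * inner ℝ x v * ((‖x‖ ^ 2)⁻¹) ^ 2) • v
    - (2 * (inner ℝ x w + inner ℝ v v) * ((‖x‖ ^ 2)⁻¹) ^ 2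
        - 8 * inner ℝ x v ^ 2 * ((‖x‖ ^ 2)⁻¹) ^ 3) • x

theorem hasDerivAt_inv_norm_sq {c : ℝ → E3} {v : E3} {s : ℝ} (h : HasDerivAt c v s)
    (h0 : c s ≠ 0) :
    HasDerivAt (fun u => (‖c u‖ ^ 2)⁻¹) (-(2 * inner ℝ (c s) v * ((‖c s‖ ^ 2)⁻¹) ^ 2)) s := by
  have hn : ‖c s‖ ^ 2 ≠ 0 := by simpa using h0
  have := h.norm_sq.fun_inv hn
  refine this.congr_deriv ?_
  field_simp

theorem hasDerivAt_inversion {c : ℝ → E3} {v : E3} {s : ℝ} (h : HasDerivAt c v s)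
    (h0 : c s ≠ 0) :
    HasDerivAt (fun u => inversion (0 : E3) 1 (c u)) (inversionDeriv (c s) v) s := by
  simp only [inversion_zero_one]
  refine ((hasDerivAt_inv_norm_sq h h0).fun_smul h).congr_deriv ?_
  rw [inversionDeriv]
  module

theorem hasDerivAt_inversionDeriv {c d : ℝ → E3} {w : E3} {s : ℝ} (h : HasDerivAt c (d s) s)
    (h' : HasDerivAt d w s) (h0 : c s ≠ 0) :
    HasDerivAt (fun u => inversionDeriv (c u) (d u)) (inversionDeriv₂ (c s) (d s) w) s := by
  have hn := hasDerivAt_inv_norm_sq h h0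
  have h1 := hn.fun_smul h'
  have h2 := (((h.inner ℝ h').const_mul 2).fun_mul (hn.fun_pow 2)).fun_smul h
  refine (h1.fun_sub h2).congr_deriv ?_
  rw [inversionDeriv₂]
  norm_num
  module

theorem deriv_inversion_comp {c : ℝ → E3} (hc : Differentiable ℝ c) {s : ℝ} (h0 : c s ≠ 0) :
    deriv (fun u => inversion (0 : E3) 1 (c u)) s = inversionDeriv (c s) (deriv c s) :=
  (hasDerivAt_inversion (hc s).hasDerivAt h0).deriv

theorem deriv_deriv_inversion_comp {c : ℝ → E3} (hc : Differentiable ℝ c)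
    (hc' : Differentiable ℝ (deriv c)) {s : ℝ} (h0 : c s ≠ 0) :
    deriv (deriv fun u => inversion (0 : E3) 1 (c u)) s
      = inversionDeriv₂ (c s) (deriv c s) (deriv (deriv c) s) := by
  have hev : deriv (fun u => inversion (0 : E3) 1 (c u))
      =ᶠ[nhds s] fun u => inversionDeriv (c u) (deriv c u) := by
    filter_upwards [hc.continuous.continuousAt.eventually_ne h0] with u hu
    exact deriv_inversion_comp hc hu
  rw [hev.deriv_eq]
  exact (hasDerivAt_inversionDeriv (hc s).hasDerivAt (hc' s).hasDerivAt h0).deriv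

/-- The differential is `|x|⁻²` times the reflection in the plane orthogonal to `x`, so the
inversion is conformal. -/
theorem inner_inversionDeriv {x : E3} (hx : x ≠ 0) (v w : E3) :
    inner ℝ (inversionDeriv x v) (inversionDeriv x w) = ((‖x‖ ^ 2)⁻¹) ^ 2 * inner ℝ v w := by
  have hn : ‖x‖ ^ 2 ≠ 0 := by simpa using hx
  simp only [inversionDeriv, inner_sub_left, inner_sub_right, inner_smul_left, inner_smul_right,
    real_inner_self_eq_norm_sq, real_inner_comm v x, RCLike.conj_to_real]
  field_simp
  ring

theorem contDiff_sLine {X : ℝ × ℝ → E3} (hX : ContDiff ℝ (⊤ : ℕ∞) X) (t : ℝ) :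
    ContDiff ℝ (⊤ : ℕ∞) fun s => X (s, t) := by fun_prop

theorem contDiff_tLine {X : ℝ × ℝ → E3} (hX : ContDiff ℝ (⊤ : ℕ∞) X) (s : ℝ) :
    ContDiff ℝ (⊤ : ℕ∞) fun t => X (s, t) := by fun_prop

theorem differentiable_and_deriv {c : ℝ → E3} (hc : ContDiff ℝ (⊤ : ℕ∞) c) :
    Differentiable ℝ c ∧ Differentiable ℝ (deriv c) := by
  have := contDiff_infty_iff_deriv.1 hc
  exact ⟨this.1, this.2.differentiable (by simp)⟩

section Inverse

variable {X : ℝ × ℝ → E3} {p : ℝ × ℝ}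

theorem partialS_inversion (hX : ContDiff ℝ (⊤ : ℕ∞) X) (h0 : X p ≠ 0) :
    partialS (fun q => inversion (0 : E3) 1 (X q)) p = inversionDeriv (X p) (partialS X p) :=
  deriv_inversion_comp (c := fun s => X (s, p.2))
    (differentiable_and_deriv (contDiff_sLine hX p.2)).1 h0

theorem partialT_inversion (hX : ContDiff ℝ (⊤ : ℕ∞) X) (h0 : X p ≠ 0) :
    partialT (fun q => inversion (0 : E3) 1 (X q)) p = inversionDeriv (X p) (partialT X p) :=
  deriv_inversion_comp (c := fun t => X (p.1, t))
    (differentiable_and_deriv (contDiff_tLine hX p.1)).1 h0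

theorem partialS_partialS_inversion (hX : ContDiff ℝ (⊤ : ℕ∞) X) (h0 : X p ≠ 0) :
    partialS (partialS fun q => inversion (0 : E3) 1 (X q)) p
      = inversionDeriv₂ (X p) (partialS X p) (partialS (partialS X) p) :=
  have h := differentiable_and_deriv (contDiff_sLine hX p.2)
  deriv_deriv_inversion_comp (c := fun s => X (s, p.2)) h.1 h.2 h0

theorem partialT_partialT_inversion (hX : ContDiff ℝ (⊤ : ℕ∞) X) (h0 : X p ≠ 0) :
    partialT (partialT fun q => inversion (0 : E3) 1 (X q)) p
      = inversionDeriv₂ (X p) (partialT X p) (partialT (partialT X) p) :=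
  have h := differentiable_and_deriv (contDiff_tLine hX p.1)
  deriv_deriv_inversion_comp (c := fun t => X (p.1, t)) h.1 h.2 h0

theorem IsConformalAt.inversion {μ : ℝ} (h : IsConformalAt X p μ) (hX : ContDiff ℝ (⊤ : ℕ∞) X)
    (h0 : X p ≠ 0) :
    IsConformalAt (fun q => EuclideanGeometry.inversion (0 : E3) 1 (X q)) p
      (((‖X p‖ ^ 2)⁻¹) ^ 2 * μ) where
  pos := by
    have := h.pos
    have : 0 < ‖X p‖ := norm_pos_iff.2 h0
    positivity
  inner_ss := by rw [partialS_inversion hX h0, inner_inversionDeriv h0, h.inner_ss]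
  inner_st := by
    rw [partialS_inversion hX h0, partialT_inversion hX h0, inner_inversionDeriv h0, h.inner_st,
      mul_zero]
  inner_tt := by rw [partialT_inversion hX h0, inner_inversionDeriv h0, h.inner_tt]

/-- The inverse of a conformally parametrized minimal surface is `-4`-stationary. -/
theorem IsConformalAt.meanCurvature_inversion {μ : ℝ} (h : IsConformalAt X p μ)
    (hX : ContDiff ℝ (⊤ : ℕ∞) X) (h0 : X p ≠ 0)
    (hharm : partialS (partialS X) p + partialT (partialT X) p = 0) :
    meanCurvature (fun q => EuclideanGeometry.inversion (0 : E3) 1 (X q)) p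
      = -4 * (inner ℝ (unitNormal (fun q => EuclideanGeometry.inversion (0 : E3) 1 (X q)) p)
          (EuclideanGeometry.inversion (0 : E3) 1 (X p))
        / ‖EuclideanGeometry.inversion (0 : E3) 1 (X p)‖ ^ 2) := by
  rw [(h.inversion hX h0).meanCurvature_eq, partialS_partialS_inversion hX h0,
    partialT_partialT_inversion hX h0]
  have hs := inner_partialS_unitNormal (fun q => EuclideanGeometry.inversion (0 : E3) 1 (X q)) p
  have ht := inner_partialT_unitNormal (fun q => EuclideanGeometry.inversion (0 : E3) 1 (X q)) p
  rw [partialS_inversion hX h0] at hs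
  rw [partialT_inversion hX h0] at ht
  generalize unitNormal (fun q => EuclideanGeometry.inversion (0 : E3) 1 (X q)) p = ν at *
  have hn : ‖X p‖ ≠ 0 := norm_ne_zero_iff.2 h0
  have hμ := h.pos.ne'
  have hE := h.inner_ss
  have hG := h.inner_tt
  -- The `w`-terms cancel by harmonicity. The velocity terms regroup into tangent vectors of the
  -- inverse surface, which `ν` annihilates; only the multiple of `X p` contributes.
  have hlap : inversionDeriv₂ (X p) (partialS X p) (partialS (partialS X) p)
      + inversionDeriv₂ (X p) (partialT X p) (partialT (partialT X) p)
      = (-4 * (‖X p‖ ^ 2)⁻¹) • (inner ℝ (X p) (partialS X p) • inversionDeriv (X p) (partialS X p)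
          + inner ℝ (X p) (partialT X p) • inversionDeriv (X p) (partialT X p))
        - (4 * μ * ((‖X p‖ ^ 2)⁻¹) ^ 2) • X p := by
    rw [eq_neg_of_add_eq_zero_right hharm]
    simp only [inversionDeriv₂, inversionDeriv, hE, hG, inner_neg_right]
    module
  rw [hlap, inversion_zero_one, norm_smul]
  simp only [inner_sub_left, inner_add_left, inner_smul_left, inner_smul_right, hs, ht,
    RCLike.conj_to_real, real_inner_comm ν (X p), norm_inv, norm_pow, norm_norm]
  rw [real_inner_comm]
  field_simp
  ring

end Inverse

/-! ### The explicit Björling solution. -/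

/-- The solution of the Björling problem for the half-twisting field along the unit circle. -/
noncomputable def mobiusMap (p : ℝ × ℝ) : E3 :=
  !₂[cos p.1 * cosh p.2 - 1 / 3 * (sin (3 * (p.1 / 2)) * sinh (3 * (p.2 / 2)))
      + sin (p.1 / 2) * sinh (p.2 / 2),
    sin p.1 * cosh p.2 + 1 / 3 * (cos (3 * (p.1 / 2)) * sinh (3 * (p.2 / 2)))
      - cos (p.1 / 2) * sinh (p.2 / 2),
    2 * (cos (p.1 / 2) * sinh (p.2 / 2))]

/-- The partial derivative of `mobiusMap` in `s`. -/
noncomputable def mobiusMapS (p : ℝ × ℝ) : E3 :=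
  !₂[-sin p.1 * cosh p.2 - 1 / 2 * (cos (3 * (p.1 / 2)) * sinh (3 * (p.2 / 2)))
      + 1 / 2 * (cos (p.1 / 2) * sinh (p.2 / 2)),
    cos p.1 * cosh p.2 - 1 / 2 * (sin (3 * (p.1 / 2)) * sinh (3 * (p.2 / 2)))
      + 1 / 2 * (sin (p.1 / 2) * sinh (p.2 / 2)),
    -(sin (p.1 / 2) * sinh (p.2 / 2))]

/-- The partial derivative of `mobiusMap` in `t`. -/
noncomputable def mobiusMapT (p : ℝ × ℝ) : E3 :=
  !₂[cos p.1 * sinh p.2 - 1 / 2 * (sin (3 * (p.1 / 2)) * cosh (3 * (p.2 / 2)))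
      + 1 / 2 * (sin (p.1 / 2) * cosh (p.2 / 2)),
    sin p.1 * sinh p.2 + 1 / 2 * (cos (3 * (p.1 / 2)) * cosh (3 * (p.2 / 2)))
      - 1 / 2 * (cos (p.1 / 2) * cosh (p.2 / 2)),
    cos (p.1 / 2) * cosh (p.2 / 2)]

/-- The second partial derivative of `mobiusMap` in `s`. -/
noncomputable def mobiusMapSS (p : ℝ × ℝ) : E3 :=
  !₂[-cos p.1 * cosh p.2 + 3 / 4 * (sin (3 * (p.1 / 2)) * sinh (3 * (p.2 / 2)))
      - 1 / 4 * (sin (p.1 / 2) * sinh (p.2 / 2)),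
    -sin p.1 * cosh p.2 - 3 / 4 * (cos (3 * (p.1 / 2)) * sinh (3 * (p.2 / 2)))
      + 1 / 4 * (cos (p.1 / 2) * sinh (p.2 / 2)),
    -(1 / 2 * (cos (p.1 / 2) * sinh (p.2 / 2)))]

theorem contDiff_mobiusMap : ContDiff ℝ (⊤ : ℕ∞) mobiusMap := by
  rw [contDiff_euclidean]
  intro i
  fin_cases i <;> simp [mobiusMap] <;> fun_prop

theorem hasDerivAt_toLp_three {f g h : ℝ → ℝ} {f' g' h' x : ℝ} (hf : HasDerivAt f f' x)
    (hg : HasDerivAt g g' x) (hh : HasDerivAt h h' x) :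
    HasDerivAt (fun u => (!₂[f u, g u, h u] : E3)) !₂[f', g', h'] x := by
  refine ((PiLp.hasFDerivAt_toLp 2 (𝕜 := ℝ) _).comp_hasDerivAt x (f := fun u => ![f u, g u, h u])
    (f' := ![f', g', h']) ?_).congr_deriv ?_
  · rw [hasDerivAt_pi]
    intro i
    fin_cases i <;> simpa
  · rfl

theorem partialS_mobiusMap : partialS mobiusMap = mobiusMapS := by
  funext p
  refine HasDerivAt.deriv (hasDerivAt_toLp_three ?_ ?_ ?_)
  all_goals
    have h1 := hasDerivAt_id p.1
    have h2 := h1.div_const 2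
    have h3 := h2.const_mul 3
  · refine (((h1.cos.mul_const (cosh p.2)).fun_sub
      ((h3.sin.mul_const (sinh (3 * (p.2 / 2)))).const_mul (1 / 3))).fun_add
      (h2.sin.mul_const (sinh (p.2 / 2)))).congr_deriv ?_
    simp only [id]; ring
  · refine (((h1.sin.mul_const (cosh p.2)).fun_add
      ((h3.cos.mul_const (sinh (3 * (p.2 / 2)))).const_mul (1 / 3))).fun_sub
      (h2.cos.mul_const (sinh (p.2 / 2)))).congr_deriv ?_
    simp only [id]; ring
  · refine ((h2.cos.mul_const (sinh (p.2 / 2))).const_mul 2).congr_deriv ?_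
    simp only [id]; ring

theorem partialT_mobiusMap : partialT mobiusMap = mobiusMapT := by
  funext p
  refine HasDerivAt.deriv (hasDerivAt_toLp_three ?_ ?_ ?_)
  all_goals
    have h1 := hasDerivAt_id p.2
    have h2 := h1.div_const 2
    have h3 := h2.const_mul 3
  · refine (((h1.cosh.const_mul (cos p.1)).fun_sub
      ((h3.sinh.const_mul (sin (3 * (p.1 / 2)))).const_mul (1 / 3))).fun_add
      (h2.sinh.const_mul (sin (p.1 / 2)))).congr_deriv ?_
    simp only [id]; ring
  · refine (((h1.cosh.const_mul (sin p.1)).fun_add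
      ((h3.sinh.const_mul (cos (3 * (p.1 / 2)))).const_mul (1 / 3))).fun_sub
      (h2.sinh.const_mul (cos (p.1 / 2)))).congr_deriv ?_
    simp only [id]; ring
  · refine ((h2.sinh.const_mul (cos (p.1 / 2))).const_mul 2).congr_deriv ?_
    simp only [id]; ring

theorem partialS_mobiusMapS : partialS mobiusMapS = mobiusMapSS := by
  funext p
  refine HasDerivAt.deriv (hasDerivAt_toLp_three ?_ ?_ ?_)
  all_goals
    have h1 := hasDerivAt_id p.1
    have h2 := h1.div_const 2
    have h3 := h2.const_mul 3
  · refine (((h1.sin.fun_neg.mul_const (cosh p.2)).fun_sub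
      ((h3.cos.mul_const (sinh (3 * (p.2 / 2)))).const_mul (1 / 2))).fun_add
      ((h2.cos.mul_const (sinh (p.2 / 2))).const_mul (1 / 2))).congr_deriv ?_
    simp only [id]; ring
  · refine (((h1.cos.mul_const (cosh p.2)).fun_sub
      ((h3.sin.mul_const (sinh (3 * (p.2 / 2)))).const_mul (1 / 2))).fun_add
      ((h2.sin.mul_const (sinh (p.2 / 2))).const_mul (1 / 2))).congr_deriv ?_
    simp only [id]; ring
  · refine (h2.sin.mul_const (sinh (p.2 / 2))).fun_neg.congr_deriv ?_
    simp only [id]; ring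

theorem partialT_mobiusMapT : partialT mobiusMapT = -mobiusMapSS := by
  funext p
  have e : (-mobiusMapSS) p = !₂[-(mobiusMapSS p 0), -(mobiusMapSS p 1), -(mobiusMapSS p 2)] := by
    ext i; fin_cases i <;> simp
  rw [e]
  refine HasDerivAt.deriv (hasDerivAt_toLp_three ?_ ?_ ?_)
  all_goals
    have h1 := hasDerivAt_id p.2
    have h2 := h1.div_const 2
    have h3 := h2.const_mul 3
  · refine (((h1.sinh.const_mul (cos p.1)).fun_sub
      ((h3.cosh.const_mul (sin (3 * (p.1 / 2)))).const_mul (1 / 2))).fun_add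
      ((h2.cosh.const_mul (sin (p.1 / 2))).const_mul (1 / 2))).congr_deriv ?_
    simp [mobiusMapSS]; ring
  · refine (((h1.sinh.const_mul (sin p.1)).fun_add
      ((h3.cosh.const_mul (cos (3 * (p.1 / 2)))).const_mul (1 / 2))).fun_sub
      ((h2.cosh.const_mul (cos (p.1 / 2))).const_mul (1 / 2))).congr_deriv ?_
    simp [mobiusMapSS]; ring
  · refine (h2.cosh.const_mul (cos (p.1 / 2))).congr_deriv ?_
    simp [mobiusMapSS]; ring

theorem mobiusMap_harmonic (p : ℝ × ℝ) :
    partialS (partialS mobiusMap) p + partialT (partialT mobiusMap) p = 0 := by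
  simp [partialS_mobiusMap, partialT_mobiusMap, partialS_mobiusMapS, partialT_mobiusMapT]

theorem isConformalAt_mobiusMap (p : ℝ × ℝ) :
    IsConformalAt mobiusMap p ((cosh (p.2 / 2) * cosh p.2 - sin (p.1 / 2) * sinh p.2) ^ 2) := by
  obtain ⟨s, t⟩ := p
  -- In half-angles all terms become polynomials in `sin u`, `cos u`, `sinh v`, `cosh v`, and the
  -- identities hold modulo `e1` and `e2`.
  obtain ⟨u, rfl⟩ : ∃ u, s = 2 * u := ⟨s / 2, by ring⟩
  obtain ⟨v, rfl⟩ : ∃ v, t = 2 * v := ⟨t / 2, by ring⟩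
  have e1 : cos u ^ 2 = 1 - sin u ^ 2 := cos_sq' u
  have e2 : cosh v ^ 2 = sinh v ^ 2 + 1 := cosh_sq v
  -- The square root of the factor never vanishes: `|sin u * sinh (2v)| ≤ |sinh (2v)| < cosh (2v) ≤
  -- cosh v * cosh (2v)`.
  refine ⟨?_, ?_, ?_, ?_⟩
  · have h1 : |sin u| ≤ 1 := abs_sin_le_one u
    have h2 : |sinh (2 * v)| < cosh (2 * v) := by
      rw [abs_lt]
      constructor
      · have := sinh_lt_cosh (-(2 * v)); rw [sinh_neg, cosh_neg] at this; linarith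
      · exact sinh_lt_cosh _
    have h3 : sin u * sinh (2 * v) ≤ |sinh (2 * v)| := by
      refine (le_abs_self _).trans ?_
      rw [abs_mul]
      exact mul_le_of_le_one_left (abs_nonneg _) h1
    have h4 : cosh (2 * v) ≤ cosh v * cosh (2 * v) :=
      le_mul_of_one_le_left (cosh_pos _).le (one_le_cosh v)
    simp only [mul_div_cancel_left₀ _ (two_ne_zero' ℝ)]
    have : 0 < cosh v * cosh (2 * v) - sin u * sinh (2 * v) := by linarith
    positivity
  all_goals
    simp only [partialS_mobiusMap, partialT_mobiusMap, inner_eq_sum_three, mobiusMapS, mobiusMapT,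
      mul_div_cancel_left₀ _ (two_ne_zero' ℝ), cos_three_mul, sin_three_mul, sinh_three_mul,
      cosh_three_mul, cos_two_mul, sin_two_mul, cosh_two_mul, sinh_two_mul]
    simp
    generalize sin u = σ at *
    generalize cos u = c at *
    generalize sinh v = h at *
    generalize cosh v = C at *
    grind

theorem mobiusMap_axis (s : ℝ) : mobiusMap (s, 0) = unitCircle s := by
  simp [mobiusMap, unitCircle]

theorem norm_halfTwist (s : ℝ) : ‖halfTwist s‖ = 1 := by
  rw [← sq_eq_sq₀ (norm_nonneg _) zero_le_one, ← real_inner_self_eq_norm_sq, inner_eq_sum_three]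
  simp [halfTwist, unitCircle]
  linear_combination cos (s / 2) ^ 2 * cos_sq_add_sin_sq s + cos_sq_add_sin_sq (s / 2)

theorem cross_mobiusMap_axis (s : ℝ) :
    cross (partialS mobiusMap (s, 0)) (partialT mobiusMap (s, 0)) = halfTwist s := by
  obtain ⟨u, rfl⟩ : ∃ u, s = 2 * u := ⟨s / 2, by ring⟩
  have e1 : cos u ^ 2 = 1 - sin u ^ 2 := cos_sq' u
  ext i
  fin_cases i <;>
    simp [partialS_mobiusMap, partialT_mobiusMap, mobiusMapS, mobiusMapT, cross, crossProduct,
      halfTwist, unitCircle, cos_three_mul, sin_three_mul, cos_two_mul, sin_two_mul] <;>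
    generalize sin u = σ at * <;> generalize cos u = c at * <;> grind

theorem unitNormal_mobiusMap_axis (s : ℝ) : unitNormal mobiusMap (s, 0) = halfTwist s := by
  rw [unitNormal, cross_mobiusMap_axis, norm_halfTwist, inv_one, one_smul]

theorem meanCurvature_mobiusMap (p : ℝ × ℝ) : meanCurvature mobiusMap p = 0 := by
  rw [(isConformalAt_mobiusMap p).meanCurvature_eq, mobiusMap_harmonic, inner_zero_left, zero_div]

theorem isImmersedOn_mobiusMap {Ω : Set (ℝ × ℝ)} (hΩ : IsOpen Ω) : IsImmersedOn mobiusMap Ω where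
  isOpen := hΩ
  smooth := contDiff_mobiusMap.contDiffOn
  immersive p _ := (isConformalAt_mobiusMap p).linearIndependent

theorem strip_eq (ε : ℝ) : strip ε = Set.univ ×ˢ Set.Ioo (-ε) ε := by
  ext p; simp [strip, abs_lt]

theorem isBjorlingSolution_mobiusMap {ε : ℝ} (hε : 0 < ε) :
    IsBjorlingSolution unitCircle halfTwist (strip ε) mobiusMap where
  toIsImmersedOn := isImmersedOn_mobiusMap (by rw [strip_eq]; exact isOpen_univ.prod isOpen_Ioo)
  connected := by
    rw [strip_eq]
    exact isConnected_univ.prod (isConnected_Ioo (by linarith))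
  axis_mem s := by simpa [strip] using hε
  minimal p _ := meanCurvature_mobiusMap p
  curve := mobiusMap_axis
  normal := unitNormal_mobiusMap_axis

/-! ### Injectivity up to the deck transformation. -/

/-- The radial component of the horizontal part of `mobiusMap` at `(s, t)`, in terms of
`x + i y = sinh (t / 2) exp (i s / 2)`. -/
noncomputable def radialPart (x y : ℝ) : ℝ :=
  1 + 2 * (x ^ 2 + y ^ 2) - 2 * y - 4 / 3 * (x ^ 2 + y ^ 2) * y

/-- The angular component of the horizontal part of `mobiusMap`. -/
noncomputable def angularPart (x y : ℝ) : ℝ := 4 / 3 * (x ^ 2 + y ^ 2) * x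

/-- In this form the parameters enter only through `exp (i s)` and `w = sinh (t/2) exp (i s/2)`,
both unchanged by `(s, t) ↦ (s + 2π, -t)`. -/
theorem mobiusMap_eq (s t : ℝ) :
    mobiusMap (s, t) =
      !₂[cos s * radialPart (sinh (t / 2) * cos (s / 2)) (sinh (t / 2) * sin (s / 2))
          - sin s * angularPart (sinh (t / 2) * cos (s / 2)) (sinh (t / 2) * sin (s / 2)),
        sin s * radialPart (sinh (t / 2) * cos (s / 2)) (sinh (t / 2) * sin (s / 2))
          + cos s * angularPart (sinh (t / 2) * cos (s / 2)) (sinh (t / 2) * sin (s / 2)),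
        2 * (sinh (t / 2) * cos (s / 2))] := by
  obtain ⟨u, rfl⟩ : ∃ u, s = 2 * u := ⟨s / 2, by ring⟩
  obtain ⟨v, rfl⟩ : ∃ v, t = 2 * v := ⟨t / 2, by ring⟩
  have e1 : cos u ^ 2 = 1 - sin u ^ 2 := cos_sq' u
  have e2 : cosh v ^ 2 = sinh v ^ 2 + 1 := cosh_sq v
  ext i
  fin_cases i <;>
    simp [mobiusMap, radialPart, angularPart, mul_div_cancel_left₀ _ (two_ne_zero' ℝ),
      cos_three_mul, sin_three_mul, sinh_three_mul, cos_two_mul, sin_two_mul, cosh_two_mul] <;>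
    generalize sin u = σ at * <;> generalize cos u = c at * <;>
    generalize sinh v = h at * <;> generalize cosh v = C at * <;> grind

theorem radialPart_pos {x y : ℝ} (h : x ^ 2 + y ^ 2 ≤ 1 / 100) : 3 / 4 < radialPart x y := by
  have hy : |y| ≤ 1 / 10 := abs_le_of_sq_le_sq (by nlinarith [sq_nonneg x]) (by norm_num)
  obtain ⟨h1, h2⟩ := abs_le.1 hy
  have h3 : (x ^ 2 + y ^ 2) * y ≤ 1 / 100 * (1 / 10) :=
    mul_le_mul_of_nonneg h h2 (by positivity) (by norm_num)
  unfold radialPart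
  nlinarith [sq_nonneg x, sq_nonneg y]

/-- On a small disc, `x` and the distance from the vertical axis determine `y`. -/
theorem eq_of_radialPart_sq_add_angularPart_sq {x y y' : ℝ} (h : x ^ 2 + y ^ 2 ≤ 1 / 100)
    (h' : x ^ 2 + y' ^ 2 ≤ 1 / 100)
    (heq : radialPart x y ^ 2 + angularPart x y ^ 2
      = radialPart x y' ^ 2 + angularPart x y' ^ 2) : y = y' := by
  have hy : |y| ≤ 1 / 10 := abs_le_of_sq_le_sq (by nlinarith [sq_nonneg x]) (by norm_num)
  have hy' : |y'| ≤ 1 / 10 := abs_le_of_sq_le_sq (by nlinarith [sq_nonneg x]) (by norm_num)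
  obtain ⟨h1, h2⟩ := abs_le.1 hy
  obtain ⟨h1', h2'⟩ := abs_le.1 hy'
  have hA := radialPart_pos h
  have hA' := radialPart_pos h'
  have hyy : 0 ≤ x ^ 2 + y ^ 2 + y * y' + y' ^ 2 := by
    nlinarith [sq_nonneg (y + y'), sq_nonneg x, sq_nonneg y, sq_nonneg y']
  -- The difference of the two squared distances is divisible by `y - y'`. In the cofactor, the
  -- radial part is at most `-1` and the angular part is tiny, so the cofactor cannot vanish.
  have hfac : (y - y') * ((2 * (y + y') - 2 - 4 / 3 * (x ^ 2 + y ^ 2 + y * y' + y' ^ 2))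
      * (radialPart x y + radialPart x y')
      + 16 / 9 * x ^ 2 * ((y + y') * (x ^ 2 + y ^ 2 + (x ^ 2 + y' ^ 2)))) = 0 := by
    unfold radialPart angularPart at *
    linear_combination heq
  have hx : x ^ 2 ≤ 1 / 100 := by nlinarith [sq_nonneg y]
  have b1 : (2 * (y + y') - 2 - 4 / 3 * (x ^ 2 + y ^ 2 + y * y' + y' ^ 2))
      * (radialPart x y + radialPart x y') ≤ -1 := by nlinarith
  have b2 : (y + y') * (x ^ 2 + y ^ 2 + (x ^ 2 + y' ^ 2)) ≤ 1 / 5 * (1 / 50) :=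
    mul_le_mul (by linarith) (by linarith) (by positivity) (by norm_num)
  have b3 : x ^ 2 * ((y + y') * (x ^ 2 + y ^ 2 + (x ^ 2 + y' ^ 2)))
      ≤ x ^ 2 * (1 / 5 * (1 / 50)) := mul_le_mul_of_nonneg_left b2 (sq_nonneg x)
  rcases mul_eq_zero.1 hfac with h0 | h0
  · linarith
  · exfalso; nlinarith

/-- The half-width of the strip on which `mobiusMap` is shown to be injective up to the
identification `(s, t) ∼ (s + 2 π, -t)`. -/
noncomputable def mobiusWidth : ℝ := 2 * arsinh (1 / 10)

theorem mobiusWidth_pos : 0 < mobiusWidth := by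
  have : 0 < arsinh (1 / 10) := arsinh_pos_iff.2 (by norm_num)
  unfold mobiusWidth; linarith

/-- The width is chosen so that `|sinh (t/2)| ≤ 1/10`, that is `|w|² ≤ 1/100`. The closed strip is
allowed because the compactness arguments need its boundary. -/
theorem sq_add_sq_le_of_abs_le {t : ℝ} (ht : |t| ≤ mobiusWidth) (s : ℝ) :
    (sinh (t / 2) * cos (s / 2)) ^ 2 + (sinh (t / 2) * sin (s / 2)) ^ 2 ≤ 1 / 100 := by
  obtain ⟨h1, h2⟩ := abs_le.1 ht
  have u : sinh (t / 2) ≤ 1 / 10 := by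
    rw [← sinh_arsinh (1 / 10), sinh_le_sinh]; unfold mobiusWidth at h2; linarith
  have l : -(1 / 10) ≤ sinh (t / 2) := by
    rw [← sinh_arsinh (1 / 10), ← sinh_neg, sinh_le_sinh]; unfold mobiusWidth at h1; linarith
  have : sinh (t / 2) ^ 2 ≤ 1 / 100 := by nlinarith
  linear_combination this + sinh (t / 2) ^ 2 * cos_sq_add_sin_sq (s / 2)

theorem exists_eq_add_two_pi_of_cos_sin {s s' : ℝ} (hc : cos s = cos s') (hs : sin s = sin s') :
    ∃ k : ℤ, s' = s + k * (2 * π) := by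
  obtain ⟨k, hk⟩ := Real.Angle.angle_eq_iff_two_pi_dvd_sub.1
    (Real.Angle.cos_sin_inj hc.symm hs.symm)
  exact ⟨k, by linear_combination hk⟩

/-- The surface even avoids the vertical axis, since the radial component exceeds `3/4`. -/
theorem mobiusMap_ne_zero {p : ℝ × ℝ} (hp : |p.2| ≤ mobiusWidth) : mobiusMap p ≠ 0 := by
  intro h
  have hA := radialPart_pos (sq_add_sq_le_of_abs_le hp p.1)
  rw [← Prod.mk.eta (p := p), mobiusMap_eq] at h
  have h0 := congrArg (fun v : E3 => v 0) h
  have h1 := congrArg (fun v : E3 => v 1) h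
  simp at h0 h1
  generalize radialPart _ _ = A at *
  generalize angularPart _ _ = B at *
  have : A = 0 := by
    linear_combination cos p.1 * h0 + sin p.1 * h1 - A * cos_sq_add_sin_sq p.1
  linarith

theorem exists_int_of_mobiusMap_eq {p q : ℝ × ℝ} (hp : |p.2| ≤ mobiusWidth) (hq : |q.2| ≤ mobiusWidth)
    (h : mobiusMap p = mobiusMap q) :
    ∃ k : ℤ, q.1 = p.1 + k * (2 * π) ∧ q.2 = (-1) ^ k * p.2 := by
  obtain ⟨s, t⟩ := p
  obtain ⟨s', t'⟩ := q
  have hd := sq_add_sq_le_of_abs_le hp s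
  have hd' := sq_add_sq_le_of_abs_le hq s'
  have hA := radialPart_pos hd
  rw [mobiusMap_eq, mobiusMap_eq] at h
  have h0 := congrArg (fun v : E3 => v 0) h
  have h1 := congrArg (fun v : E3 => v 1) h
  have h2 := congrArg (fun v : E3 => v 2) h
  clear h
  simp at h0 h1 h2
  dsimp only at *
  -- Equal heights give equal `x`; equal distances from the axis then give equal `y`.
  have hy : sinh (t / 2) * sin (s / 2) = sinh (t' / 2) * sin (s' / 2) := by
    rw [← h2] at hd' h0 h1
    refine eq_of_radialPart_sq_add_angularPart_sq hd hd' ?_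
    generalize radialPart _ (sinh (t / 2) * _) = A at *
    generalize angularPart _ (sinh (t / 2) * _) = B at *
    generalize radialPart _ _ = A' at *
    generalize angularPart _ _ = B' at *
    have e1 := cos_sq_add_sin_sq s
    have e2 := cos_sq_add_sin_sq s'
    calc A ^ 2 + B ^ 2 = (cos s * A - sin s * B) ^ 2 + (sin s * A + cos s * B) ^ 2 := by
          linear_combination -(A ^ 2 + B ^ 2) * e1
      _ = A' ^ 2 + B' ^ 2 := by
          rw [h0, h1]; linear_combination (A' ^ 2 + B' ^ 2) * e2
  rw [← h2, ← hy] at h0 h1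
  -- Now `exp (i s) (A + i B) = exp (i s') (A + i B)`; multiplying by `A - i B` and cancelling `A² +
  -- B²` leaves `exp (i s) = exp (i s')`.
  obtain ⟨k, hk⟩ : ∃ k : ℤ, s' = s + k * (2 * π) := by
    generalize radialPart _ _ = A at *
    generalize angularPart _ _ = B at *
    have hAB : A ^ 2 + B ^ 2 ≠ 0 := by positivity
    refine exists_eq_add_two_pi_of_cos_sin (mul_left_cancel₀ hAB ?_) (mul_left_cancel₀ hAB ?_)
    · linear_combination A * h0 + B * h1
    · linear_combination A * h1 - B * h0
  refine ⟨k, hk, ?_⟩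
  -- The half-angle shifts by `k π`, so equality of the two values of `w` forces the sign `(-1) ^ k`
  -- on `sinh (t/2)`.
  have hk2 : s' / 2 = s / 2 + k * π := by rw [hk]; ring
  rw [hk2, cos_add_int_mul_pi] at h2
  rw [hk2, sin_add_int_mul_pi] at hy
  have hsinh : sinh (t / 2) = (-1) ^ k * sinh (t' / 2) := by
    linear_combination cos (s / 2) * h2 + sin (s / 2) * hy
      - (sinh (t / 2) - (-1) ^ k * sinh (t' / 2)) * cos_sq_add_sin_sq (s / 2)
  rcases Int.even_or_odd k with he | ho
  · rw [he.neg_one_zpow, one_mul] at hsinh ⊢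
    have := sinh_injective hsinh
    linarith
  · rw [ho.neg_one_zpow, neg_one_mul, ← sinh_neg] at hsinh
    rw [ho.neg_one_zpow]
    have := sinh_injective hsinh
    linarith

theorem mobiusMap_add_int_mul_two_pi (k : ℤ) (s t : ℝ) :
    mobiusMap (s + k * (2 * π), (-1) ^ k * t) = mobiusMap (s, t) := by
  have h1 : (s + k * (2 * π)) / 2 = s / 2 + k * π := by ring
  rw [mobiusMap_eq, mobiusMap_eq, h1, cos_add_int_mul_pi, sin_add_int_mul_pi,
    cos_add_int_mul_two_pi, sin_add_int_mul_two_pi]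
  rcases Int.even_or_odd k with he | ho
  · simp [he.neg_one_zpow]
  · simp [ho.neg_one_zpow, neg_div]

/-! ### Embeddedness. -/

theorem isEmbedding_domRestrict_of_isCompact {α β : Type*} [TopologicalSpace α]
    [TopologicalSpace β] [T2Space β] {f : α → β} {s K : Set α} (hf : ContinuousOn f K)
    (hK : IsCompact K) (hinj : Set.InjOn f K) (hs : s ⊆ K) : IsEmbedding (s.domRestrict f) := by
  have : CompactSpace K := isCompact_iff_compactSpace.1 hK
  have h1 : IsEmbedding (K.domRestrict f) :=
    ((continuousOn_iff_continuous_domRestrict.1 hf).isClosedEmbedding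
      (Set.injOn_iff_injective.1 hinj)).isEmbedding
  exact h1.comp (IsEmbedding.inclusion hs)

theorem eq_of_mobiusMap_eq {p q : ℝ × ℝ} (hp : |p.2| ≤ mobiusWidth) (hq : |q.2| ≤ mobiusWidth)
    (hpq : |q.1 - p.1| < 2 * π) (h : mobiusMap p = mobiusMap q) : p = q := by
  obtain ⟨k, h1, h2⟩ := exists_int_of_mobiusMap_eq hp hq h
  have hk : k = 0 := by
    rw [h1, add_sub_cancel_left, abs_mul, abs_of_pos two_pi_pos] at hpq
    have : |(k : ℝ)| < 1 := by
      by_contra! hc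
      nlinarith [two_pi_pos]
    exact_mod_cast Int.abs_lt_one_iff.1 (by exact_mod_cast this)
  subst hk
  ext <;> simp_all

theorem abs_snd_eq_of_mobiusMap_eq {p q : ℝ × ℝ} (hp : |p.2| ≤ mobiusWidth)
    (hq : |q.2| ≤ mobiusWidth) (h : mobiusMap p = mobiusMap q) : |p.2| = |q.2| := by
  obtain ⟨k, -, h2⟩ := exists_int_of_mobiusMap_eq hp hq h
  rw [h2, abs_mul, abs_zpow, abs_neg, abs_one, one_zpow, one_mul]

theorem exists_mobiusMap_eq_of_fst_mem_Ioc (a : ℝ) (p : ℝ × ℝ) :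
    ∃ q : ℝ × ℝ, q.1 ∈ Set.Ioc a (a + 2 * π) ∧ |q.2| = |p.2| ∧ mobiusMap q = mobiusMap p := by
  obtain ⟨k, hk, -⟩ := existsUnique_add_zsmul_mem_Ioc two_pi_pos p.1 a
  exact ⟨(p.1 + k * (2 * π), (-1) ^ k * p.2), by simpa using hk,
    by rw [abs_mul, abs_zpow, abs_neg, abs_one, one_zpow, one_mul],
    mobiusMap_add_int_mul_two_pi k p.1 p.2⟩

theorem isLocalParam_mobiusMap (s₀ : ℝ) :
    IsLocalParam (mobiusMap '' strip mobiusWidth)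
      (Set.Ioo (s₀ - 1) (s₀ + 1) ×ˢ Set.Ioo (-mobiusWidth) mobiusWidth) mobiusMap where
  toIsImmersedOn := isImmersedOn_mobiusMap (isOpen_Ioo.prod isOpen_Ioo)
  embedding := by
    refine isEmbedding_domRestrict_of_isCompact
      (K := Set.Icc (s₀ - 1) (s₀ + 1) ×ˢ Set.Icc (-mobiusWidth) mobiusWidth)
      contDiff_mobiusMap.continuous.continuousOn (isCompact_Icc.prod isCompact_Icc) ?_
      (Set.prod_mono Set.Ioo_subset_Icc_self Set.Ioo_subset_Icc_self)
    rintro p ⟨hp1, hp2⟩ q ⟨hq1, hq2⟩ h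
    refine eq_of_mobiusMap_eq (abs_le.2 hp2) (abs_le.2 hq2) ?_ h
    have := pi_gt_three
    rw [abs_lt]
    constructor <;> linarith [hp1.1, hp1.2, hq1.1, hq1.2]
  relOpen := by
    -- `K` is the rest of a full period over the closed strip. Its image is compact, and within the
    -- surface the complement of that image is exactly the image of the window.
    set K : Set (ℝ × ℝ) :=
      Set.Icc (s₀ + 1) (s₀ - 1 + 2 * π) ×ˢ Set.Icc (-mobiusWidth) mobiusWidth with hK
    have hKc : IsCompact K := isCompact_Icc.prod isCompact_Icc
    refine ⟨(mobiusMap '' K)ᶜ,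
      (hKc.image contDiff_mobiusMap.continuous).isClosed.isOpen_compl, ?_⟩
    have hpi := pi_gt_three
    ext x
    constructor
    · rintro ⟨p, ⟨hp1, hp2⟩, rfl⟩
      refine ⟨⟨p, by simpa [strip, abs_lt] using hp2, rfl⟩, ?_⟩
      rintro ⟨q, ⟨hq1, hq2⟩, h⟩
      have := eq_of_mobiusMap_eq (abs_le.2 hq2) (abs_le.2 ⟨hp2.1.le, hp2.2.le⟩)
        (by rw [abs_lt]; constructor <;> linarith [hp1.1, hp1.2, hq1.1, hq1.2]) h
      subst this
      linarith [hp1.2, hq1.1]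
    · rintro ⟨⟨p, hp, rfl⟩, hx⟩
      obtain ⟨q, hq1, hq2, hq⟩ := exists_mobiusMap_eq_of_fst_mem_Ioc (s₀ - 1) p
      have hq' : |q.2| < mobiusWidth := hq2.trans_lt hp
      refine ⟨q, ⟨⟨hq1.1, ?_⟩, abs_lt.1 hq'⟩, hq⟩
      by_contra! hc
      exact hx ⟨q, ⟨⟨hc, hq1.2⟩, abs_le.1 hq'.le⟩, hq⟩

theorem mem_localDomain {p : ℝ × ℝ} (hp : p ∈ strip mobiusWidth) :
    p ∈ Set.Ioo (p.1 - 1) (p.1 + 1) ×ˢ Set.Ioo (-mobiusWidth) mobiusWidth :=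
  ⟨by simp, abs_lt.1 hp⟩

theorem isMinimalSurface_mobiusMap : IsMinimalSurface (mobiusMap '' strip mobiusWidth) := by
  rintro _ ⟨p, hp, rfl⟩
  exact ⟨_, mobiusMap, isLocalParam_mobiusMap p.1,
    Set.mem_image_of_mem _ (mem_localDomain hp), fun q _ => meanCurvature_mobiusMap q⟩

theorem zero_notMem_mobiusMap : (0 : E3) ∉ mobiusMap '' strip mobiusWidth := by
  rintro ⟨p, hp, h⟩
  exact mobiusMap_ne_zero (le_of_lt hp) h

/-! ### Topology of the Möbius strip. -/

/-- The parametrization of the image of `mobiusMap` by the model of the Möbius strip. -/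
noncomputable def mobiusParam (p : Set.Icc (0 : ℝ) 1 × Set.Ioo (-1 : ℝ) 1) :
    mobiusMap '' strip mobiusWidth :=
  ⟨mobiusMap (2 * π * p.1, mobiusWidth * p.2), _, by
    have h := mobiusWidth_pos
    simpa [strip, abs_mul, abs_of_pos h] using mul_lt_of_lt_one_right h (abs_lt.2 p.2.2), rfl⟩

theorem continuous_mobiusParam : Continuous mobiusParam := by
  refine Continuous.subtype_mk (contDiff_mobiusMap.continuous.comp ?_) _
  fun_prop

/-- The open model is not compact, so the map is extended to `[0, 1] × [-1, 1]`, where it is closed.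
Restricting to the preimage of the surface keeps it closed and onto, hence a quotient map. This
restriction factors through `mobiusParam`, because the image point determines `|t|` and so no
boundary point lies over the surface. -/
theorem isQuotientMap_mobiusParam : IsQuotientMap mobiusParam := by
  have hw := mobiusWidth_pos
  let G : Set.Icc (0 : ℝ) 1 × Set.Icc (-1 : ℝ) 1 → E3 :=
    fun p => mobiusMap (2 * π * p.1, mobiusWidth * p.2)
  have hG : Continuous G := contDiff_mobiusMap.continuous.comp (by fun_prop)
  have hle (p : Set.Icc (0 : ℝ) 1 × Set.Icc (-1 : ℝ) 1) :
      |mobiusWidth * (p.2 : ℝ)| ≤ mobiusWidth := by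
    rw [abs_mul, abs_of_pos hw]
    exact mul_le_of_le_one_right hw.le (abs_le.2 p.2.2)
  have hlt (p : G ⁻¹' (mobiusMap '' strip mobiusWidth)) :
      (p.1.2 : ℝ) ∈ Set.Ioo (-1 : ℝ) 1 := by
    obtain ⟨p, q, hq, h⟩ := p
    have h1 := abs_snd_eq_of_mobiusMap_eq (le_of_lt hq) (hle p) h
    have h2 : |mobiusWidth * (p.2 : ℝ)| < mobiusWidth := h1 ▸ hq
    rw [abs_mul, abs_of_pos hw] at h2
    exact abs_lt.1 (lt_of_mul_lt_mul_left (by linarith) hw.le)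
  let j : G ⁻¹' (mobiusMap '' strip mobiusWidth) → Set.Icc (0 : ℝ) 1 × Set.Ioo (-1 : ℝ) 1 :=
    fun p => (p.1.1, ⟨p.1.2, hlt p⟩)
  have hj : Continuous j := by fun_prop
  refine IsQuotientMap.of_comp hj continuous_mobiusParam ?_
  refine IsClosedMap.isQuotientMap
    (f := (mobiusMap '' strip mobiusWidth).restrictPreimage G)
    (hG.isClosedMap.restrictPreimage _) hG.restrictPreimage ?_
  rintro ⟨_, p, hp, rfl⟩
  obtain ⟨q, hq1, hq2, hq⟩ := exists_mobiusMap_eq_of_fst_mem_Ioc 0 p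
  have hq' : |q.2| ≤ mobiusWidth := by rw [hq2]; exact le_of_lt hp
  have h0 := two_pi_pos
  rw [zero_add] at hq1
  have hGq : G (⟨q.1 / (2 * π), by
        constructor
        · exact div_nonneg hq1.1.le h0.le
        · exact div_le_one_of_le₀ hq1.2 h0.le⟩,
      ⟨q.2 / mobiusWidth, abs_le.1 (by
        rw [abs_div, abs_of_pos hw]; exact div_le_one_of_le₀ hq' hw.le)⟩) = mobiusMap p := by
    simp only [G]
    rw [mul_div_cancel₀ _ h0.ne', mul_div_cancel₀ _ hw.ne']
    exact hq
  exact ⟨⟨_, by rw [Set.mem_preimage, hGq]; exact ⟨p, hp, rfl⟩⟩, Subtype.ext hGq⟩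

theorem mobiusParam_eq_of_rel (p q : Set.Icc (0 : ℝ) 1 × Set.Ioo (-1 : ℝ) 1)
    (h : (p.1 : ℝ) = 0 ∧ (q.1 : ℝ) = 1 ∧ (q.2 : ℝ) = -(p.2 : ℝ)) :
    mobiusParam p = mobiusParam q := by
  refine Subtype.ext ?_
  have := mobiusMap_add_int_mul_two_pi 1 0 (mobiusWidth * p.2)
  simpa [mobiusParam, h.1, h.2.1, h.2.2] using this.symm

theorem mk_eq_mk_of_mobiusParam_eq {p q : Set.Icc (0 : ℝ) 1 × Set.Ioo (-1 : ℝ) 1}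
    (h : mobiusParam p = mobiusParam q) :
    (Quot.mk _ p : MobiusStrip) = Quot.mk _ q := by
  have hw := mobiusWidth_pos
  have hle (p : Set.Icc (0 : ℝ) 1 × Set.Ioo (-1 : ℝ) 1) :
      |mobiusWidth * (p.2 : ℝ)| ≤ mobiusWidth := by
    rw [abs_mul, abs_of_pos hw]
    exact mul_le_of_le_one_right hw.le (abs_lt.2 p.2.2).le
  obtain ⟨k, h1, h2⟩ := exists_int_of_mobiusMap_eq (hle p) (hle q) (congrArg Subtype.val h)
  dsimp only at h1 h2
  have h1 : (q.1 : ℝ) = p.1 + k :=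
    mul_left_cancel₀ two_pi_pos.ne' (by linear_combination h1)
  have h2 : (q.2 : ℝ) = (-1) ^ k * p.2 := mul_left_cancel₀ hw.ne' (by linear_combination h2)
  have hp := p.1.2
  have hq := q.1.2
  have hk1 : k ≤ 1 := by exact_mod_cast (by linarith [hp.1, hq.2] : (k : ℝ) ≤ 1)
  have hk2 : -1 ≤ k := by exact_mod_cast (by linarith [hp.2, hq.1] : (-1 : ℝ) ≤ k)
  -- First coordinates in `[0, 1]` differ by at most one; `k = ±1` forces opposite ends of the band,
  -- the glued case.
  obtain rfl | rfl | rfl : k = -1 ∨ k = 0 ∨ k = 1 := by omega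
  · push_cast at h1
    exact (Quot.sound ⟨by linarith [hp.2, hq.1], by linarith [hp.2, hq.1], by simp [h2]⟩).symm
  · have : p = q := by
      refine Prod.ext (Subtype.ext ?_) (Subtype.ext ?_) <;> simp_all
    rw [this]
  · push_cast at h1
    exact Quot.sound ⟨by linarith [hp.1, hq.2], by linarith [hp.1, hq.2], by simp [h2]⟩

theorem nonempty_homeomorph_mobiusStrip :
    Nonempty ((mobiusMap '' strip mobiusWidth) ≃ₜ MobiusStrip) := by
  let f : MobiusStrip → mobiusMap '' strip mobiusWidth :=
    Quot.lift mobiusParam mobiusParam_eq_of_rel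
  have hf : Continuous f := continuous_quot_lift mobiusParam_eq_of_rel continuous_mobiusParam
  have hq : IsQuotientMap f :=
    IsQuotientMap.of_comp continuous_quot_mk hf isQuotientMap_mobiusParam
  have hinj : Function.Injective f := by
    rintro ⟨p⟩ ⟨q⟩ h
    exact mk_eq_mk_of_mobiusParam_eq h
  exact ⟨((isHomeomorph_iff_isQuotientMap_injective.2 ⟨hq, hinj⟩).homeomorph f).symm⟩

/-! ### The inverse surface. -/

theorem continuousOn_inversion :
    ContinuousOn (inversion (0 : E3) 1) {0}ᶜ :=
  ContinuousOn.inversion continuousOn_const continuousOn_const continuousOn_id fun _ h => h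

theorem inversion_ne_zero {x : E3} (hx : x ≠ 0) : inversion (0 : E3) 1 x ≠ 0 :=
  (inversion_eq_center one_ne_zero).not.2 hx

/-- The inversion as a homeomorphism of the punctured space. -/
noncomputable def inversionHomeomorph : ({0}ᶜ : Set E3) ≃ₜ ({0}ᶜ : Set E3) where
  toFun x := ⟨inversion 0 1 x, inversion_ne_zero x.2⟩
  invFun x := ⟨inversion 0 1 x, inversion_ne_zero x.2⟩
  left_inv _ := Subtype.ext (inversion_inversion 0 one_ne_zero _)
  right_inv _ := Subtype.ext (inversion_inversion 0 one_ne_zero _)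
  continuous_toFun :=
    (continuousOn_iff_continuous_domRestrict.1 continuousOn_inversion).subtype_mk
      fun x => inversion_ne_zero x.2
  continuous_invFun :=
    (continuousOn_iff_continuous_domRestrict.1 continuousOn_inversion).subtype_mk
      fun x => inversion_ne_zero x.2

theorem isEmbedding_inversion_comp {α : Type*} [TopologicalSpace α] {f : α → E3}
    (hf : IsEmbedding f) (h0 : ∀ a, f a ≠ 0) :
    IsEmbedding fun a => inversion (0 : E3) 1 (f a) :=
  IsEmbedding.subtypeVal.comp
    (inversionHomeomorph.isEmbedding.comp (hf.codRestrict ({0}ᶜ : Set E3) h0))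

theorem nonempty_homeomorph_inversion_image {S : Set E3} (h0 : (0 : E3) ∉ S) :
    Nonempty ((inversion (0 : E3) 1 '' S) ≃ₜ S) := by
  have h := isEmbedding_inversion_comp (f := ((↑) : S → E3)) IsEmbedding.subtypeVal
    fun a ha => h0 (ha ▸ a.2)
  refine ⟨(h.toHomeomorph.trans (Homeomorph.setCongr ?_)).symm⟩
  ext x
  simp

theorem IsLocalParam.inversion {S : Set E3} {Ω : Set (ℝ × ℝ)} {X : ℝ × ℝ → E3}
    (h : IsLocalParam S Ω X) (h0 : (0 : E3) ∉ S)
    (himm : ∀ p ∈ Ω, LinearIndependent ℝ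
      ![partialS (fun q => EuclideanGeometry.inversion (0 : E3) 1 (X q)) p,
        partialT (fun q => EuclideanGeometry.inversion (0 : E3) 1 (X q)) p]) :
    IsLocalParam (EuclideanGeometry.inversion (0 : E3) 1 '' S) Ω
      fun q => EuclideanGeometry.inversion (0 : E3) 1 (X q) := by
  obtain ⟨W, hW, hSW⟩ := h.relOpen
  have hX0 : ∀ p ∈ Ω, X p ≠ 0 := fun p hp hX =>
    h0 (hX ▸ (hSW.subset (Set.mem_image_of_mem X hp)).1)
  refine ⟨⟨h.isOpen, ?_, himm⟩, ?_, ?_⟩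
  · exact ContDiffOn.inversion contDiffOn_const contDiffOn_const h.smooth hX0
  · exact isEmbedding_inversion_comp h.embedding fun a => hX0 a a.2
  -- The inversion is an involution, so it sends `S ∩ W` to the part of the inverse surface lying in
  -- the preimage of `W`. The origin is removed because continuity, hence openness of the preimage,
  -- is available only away from it.
  · refine ⟨{0}ᶜ ∩ EuclideanGeometry.inversion (0 : E3) 1 ⁻¹' W,
      continuousOn_inversion.isOpen_inter_preimage isOpen_compl_singleton hW, ?_⟩
    rw [← Set.image_image (EuclideanGeometry.inversion (0 : E3) 1) X, hSW]
    ext y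
    constructor
    · rintro ⟨x, ⟨hxS, hxW⟩, rfl⟩
      refine ⟨⟨x, hxS, rfl⟩, ?_, ?_⟩
      · rw [Set.mem_compl_singleton_iff, Ne, inversion_eq_center one_ne_zero]
        exact fun hx => h0 (hx ▸ hxS)
      · rwa [Set.mem_preimage, inversion_inversion 0 one_ne_zero]
    · rintro ⟨⟨x, hxS, rfl⟩, -, hx⟩
      rw [Set.mem_preimage, inversion_inversion 0 one_ne_zero] at hx
      exact ⟨x, ⟨hxS, hx⟩, rfl⟩

theorem isStationarySurface_inversion_mobiusMap :
    IsStationarySurface (-4) (inversion (0 : E3) 1 '' (mobiusMap '' strip mobiusWidth)) := by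
  refine ⟨?_, ?_⟩
  · rintro ⟨x, hx, h⟩
    rw [inversion_eq_center one_ne_zero] at h
    exact zero_notMem_mobiusMap (h ▸ hx)
  · rintro _ ⟨_, ⟨p, hp, rfl⟩, rfl⟩
    have hne : ∀ q ∈ Set.Ioo (p.1 - 1) (p.1 + 1) ×ˢ Set.Ioo (-mobiusWidth) mobiusWidth,
        mobiusMap q ≠ 0 := fun q hq => mobiusMap_ne_zero (abs_lt.2 hq.2).le
    refine ⟨_, _, (isLocalParam_mobiusMap p.1).inversion zero_notMem_mobiusMap ?_,
      ⟨p, mem_localDomain hp, rfl⟩, ?_⟩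
    · exact fun q hq =>
        ((isConformalAt_mobiusMap q).inversion contDiff_mobiusMap (hne q hq)).linearIndependent
    · exact fun q hq => (isConformalAt_mobiusMap q).meanCurvature_inversion contDiff_mobiusMap
        (hne q hq) (mobiusMap_harmonic q)

end ParamSurface

theorem mainTheorem7 :
    ∃ (ε : ℝ) (X : ℝ × ℝ → E3), 0 < ε ∧
      ParamSurface.IsBjorlingSolution ParamSurface.unitCircle ParamSurface.halfTwist
        (ParamSurface.strip ε) X ∧
      ParamSurface.IsMinimalSurface (X '' ParamSurface.strip ε) ∧
      Nonempty ((X '' ParamSurface.strip ε) ≃ₜ ParamSurface.MobiusStrip) ∧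
      (0 : E3) ∉ X '' ParamSurface.strip ε ∧
      ParamSurface.IsStationarySurface (-4)
        (EuclideanGeometry.inversion (0 : E3) 1 '' (X '' ParamSurface.strip ε)) ∧
      Nonempty ((EuclideanGeometry.inversion (0 : E3) 1 '' (X '' ParamSurface.strip ε)) ≃ₜ
        ParamSurface.MobiusStrip) := by
  obtain ⟨f⟩ := ParamSurface.nonempty_homeomorph_mobiusStrip
  obtain ⟨g⟩ :=
    ParamSurface.nonempty_homeomorph_inversion_image ParamSurface.zero_notMem_mobiusMap
  exact ⟨ParamSurface.mobiusWidth, ParamSurface.mobiusMap, ParamSurface.mobiusWidth_pos,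
    ParamSurface.isBjorlingSolution_mobiusMap ParamSurface.mobiusWidth_pos,
    ParamSurface.isMinimalSurface_mobiusMap, ⟨f⟩, ParamSurface.zero_notMem_mobiusMap,
    ParamSurface.isStationarySurface_inversion_mobiusMap, ⟨g.trans f⟩⟩
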